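/- Let $A\in\mathbb R^{n\times n}$, $B\in\mathbb R^{n\times m}$, $C\in\mathbb R^{p\times n}$, $D\in\mathbb R^{p\times m}$, let $\Sigma$ be the linear system $\dot x(t)=Ax(t)+Bu(t)$, $x(0)=x_0$, $y(t)=Cx(t)+Du(t)$ $(t\ge 0)$, and put $\rho=\dim(\ker B\cap\ker D)$. Inputs $u$ are causal (zero for $t<0$), piecewise continuous and exponentially bounded; the corresponding states $x$ are continuous and the outputs $y$ piecewise continuous on $[0,\infty)$. Signals are regarded as equal if they agree at almost every $t\ge 0$. Let $\mathcal U\subseteq\mathbb R^m$ and $\mathcal X\subseteq\mathbb R^n$ be arbitrary sets and let $\mathfrak S$ be the system $\Sigma$ with the constraints $u(t)\in\mathcal U$, $x(t)\in\mathcal X$ for all $t\ge 0$. For $x_0\in\mathbb R^n$ let $\mathbf Q(x_0)$ be the set of triples $(u,x,y)$ of input, state and output that satisfy the equations of $\Sigma$ with initial state $x_0$ and these constraints. A pair $(x_0,y)$, with $x_0\in\mathcal X$ and $y$ piecewise continuous, is admissible if $(u,x,y)\in\mathbf Q(x_0)$ for some $(u,x)$, and it is input redundant for $\mathfrak S$ if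 there are $(u_1,x_1,y),(u_2,x_2,y)\in\mathbf Q(x_0)$ with $u_1\neq u_2$. The system $\mathfrak S$ is input redundant if it has an input redundant pair; for $\Sigma$ the same is meant with $\mathcal U=\mathbb R^m$, $\mathcal X=\mathbb R^n$. Assume that $\Sigma$ is input redundant and that $(x_0,y)$ is admissible but not input redundant for $\mathfrak S$. Then there is a unique $(u,x)$ with $(u,x,y)\in\mathbf Q(x_0)$, and, with $\mathcal C$ the largest (relatively) open subset of $[0,\infty)$ on which $u$ is continuous (whichever almost-everywhere equal representative of $u$ in $\mathbf Q(x_0)$ is taken): - if $\rho>0$, then $u(t)\in\mathcal U\setminus\operatorname{int}(\mathcal U)$ for all $t\in\mathcal C$; - if $\rho=0$, then for every $t\in\mathcal C$, $u(t)\in\mathcal U\setminus\operatorname{int}(\mathcal U)$ or $x(t)\in\mathcal X\setminus\operatorname{int}(\mathcal X)$. -/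

import Mathlib

open Set Filter Topology MeasureTheory

/-- Vector-valued signals on the time axis `[0, ∞)`. A signal is represented by a function on `ℝ`;
only its values at nonnegative times matter in what follows. (Only the topology of `ℝᵏ` and
boundedness up to a constant factor are used, so the choice of norm on `Fin k → ℝ` is immaterial.) -/
abbrev Signal (k : ℕ) : Type := ℝ → (Fin k → ℝ)

namespace Signal

variable {k : ℕ}

/-- Equality of signals: equality at almost every time `t ≥ 0`. -/
def AEEq (f g : Signal k) : Prop :=
  f =ᵐ[volume.restrict (Ici (0 : ℝ))] g

/-- Piecewise continuity on `[0, ∞)`: finitely many discontinuities on every bounded interval, and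
finite one-sided limits everywhere. Continuity is relative to `[0, ∞)`, so at `0` it is continuity
from the right. -/
def PiecewiseContinuous (f : Signal k) : Prop :=
  (∀ T : ℝ, {t : ℝ | t ∈ Icc 0 T ∧ ¬ ContinuousWithinAt f (Ici 0) t}.Finite) ∧
  (∀ t : ℝ, 0 ≤ t → ∃ l : Fin k → ℝ, Tendsto f (𝓝[>] t) (𝓝 l)) ∧
  (∀ t : ℝ, 0 < t → ∃ l : Fin k → ℝ, Tendsto f (𝓝[<] t) (𝓝 l))

/-- Causality: the signal is zero at all strictly negative times. -/
def Causal (f : Signal k) : Prop := ∀ t : ℝ, t < 0 → f t = 0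

/-- Exponential boundedness on `[0, ∞)`. -/
def ExpBounded (f : Signal k) : Prop :=
  ∃ M a : ℝ, ∀ t : ℝ, 0 ≤ t → ‖f t‖ ≤ M * Real.exp (a * t)

/-- The largest (relatively) open subset of `[0, ∞)` on which the signal is continuous: the union of
all such subsets. -/
def continuitySet (f : Signal k) : Set ℝ :=
  ⋃₀ {O : Set ℝ | (∃ W : Set ℝ, IsOpen W ∧ O = W ∩ Ici 0) ∧ ContinuousOn f O}

end Signal

/-- The inputs of the unconstrained system: causal, piecewise continuous, exponentially bounded. -/
def freeInputs (m : ℕ) : Set (Signal m) :=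
  {u | u.Causal ∧ u.PiecewiseContinuous ∧ u.ExpBounded}

/-- The states of the unconstrained system: continuous on `[0, ∞)`. -/
def freeStates (n : ℕ) : Set (Signal n) := {x | ContinuousOn x (Ici 0)}

/-- The outputs: piecewise continuous on `[0, ∞)`. -/
def outputs (p : ℕ) : Set (Signal p) := {y | y.PiecewiseContinuous}

/-- The inputs with values in `U`. -/
def inputs {m : ℕ} (U : Set (Fin m → ℝ)) : Set (Signal m) :=
  {u | ∀ t : ℝ, 0 ≤ t → u t ∈ U} ∩ freeInputs m

/-- The states with values in `X`. -/
def states {n : ℕ} (X : Set (Fin n → ℝ)) : Set (Signal n) :=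
  {x | ∀ t : ℝ, 0 ≤ t → x t ∈ X} ∩ freeStates n

/-- The linear time-invariant system `x' = A x + B u`, `y = C x + D u`, with `m` inputs, `n` states
and `p` outputs. -/
structure LinearSystem (m n p : ℕ) where
  /-- the state matrix -/
  A : Matrix (Fin n) (Fin n) ℝ
  /-- the input matrix -/
  B : Matrix (Fin n) (Fin m) ℝ
  /-- the output matrix -/
  C : Matrix (Fin p) (Fin n) ℝ
  /-- the feedthrough matrix -/
  D : Matrix (Fin p) (Fin m) ℝ

namespace LinearSystem

variable {m n p : ℕ} (S : LinearSystem m n p)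

/-- `x` is the state trajectory produced by the input `u` from the initial state `x₀`. As `u` is only
piecewise continuous, `x' = A x + B u`, `x(0) = x₀` is read in integrated form. -/
def IsStateTrajectory (x₀ : Fin n → ℝ) (u : Signal m) (x : Signal n) : Prop :=
  ContinuousOn x (Ici 0) ∧
  ∀ t : ℝ, 0 ≤ t → x t = x₀ + ∫ s in (0 : ℝ)..t, (S.A.mulVec (x s) + S.B.mulVec (u s))

/-- The triples `(u, x, y)` compatible for `x₀` with the unconstrained system. -/
def freeTriples (x₀ : Fin n → ℝ) : Set (Signal m × Signal n × Signal p) :=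
  {q | q.1 ∈ freeInputs m ∧ S.IsStateTrajectory x₀ q.1 q.2.1 ∧
    Signal.AEEq q.2.2 (fun t => S.C.mulVec (q.2.1 t) + S.D.mulVec (q.1 t))}

/-- The triples `(u, x, y)` compatible for `x₀` with the system under the constraints
`u(t) ∈ U`, `x(t) ∈ X`. -/
def triples (U : Set (Fin m → ℝ)) (X : Set (Fin n → ℝ)) (x₀ : Fin n → ℝ) :
    Set (Signal m × Signal n × Signal p) :=
  S.freeTriples x₀ ∩ (inputs U ×ˢ (states X ×ˢ outputs p))

/-- The input-output pairs compatible for `x₀` with the constrained system. -/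
def ioPairs (U : Set (Fin m → ℝ)) (X : Set (Fin n → ℝ)) (x₀ : Fin n → ℝ) :
    Set (Signal m × Signal p) :=
  {w | ∃ x : Signal n, (w.1, x, w.2) ∈ S.triples U X x₀}

/-- The admissible pairs `(x₀, y)` of the constrained system. -/
def admissiblePairs (U : Set (Fin m → ℝ)) (X : Set (Fin n → ℝ)) :
    Set ((Fin n → ℝ) × Signal p) :=
  {a | a ∈ X ×ˢ outputs p ∧ ∃ u : Signal m, (u, a.2) ∈ S.ioPairs U X a.1}

/-- The input redundant pairs `(x₀, y)` of the constrained system: the output `y` is produced from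
`x₀` by two distinct inputs. -/
def redundantPairs (U : Set (Fin m → ℝ)) (X : Set (Fin n → ℝ)) :
    Set ((Fin n → ℝ) × Signal p) :=
  {a | a ∈ X ×ˢ outputs p ∧
    ∃ (u₁ : Signal m) (y₁ : Signal p) (u₂ : Signal m) (y₂ : Signal p),
      (u₁, y₁) ∈ S.ioPairs U X a.1 ∧ (u₂, y₂) ∈ S.ioPairs U X a.1 ∧
      ¬ Signal.AEEq u₁ u₂ ∧ Signal.AEEq y₁ y₂ ∧ Signal.AEEq y₂ a.2}

/-- The constrained system is input redundant if it has an input redundant pair. -/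
def IsInputRedundant (U : Set (Fin m → ℝ)) (X : Set (Fin n → ℝ)) : Prop :=
  (S.redundantPairs U X).Nonempty

/-- `ρ = dim (ker B ∩ ker D)`. -/
noncomputable def rho : ℕ :=
  Module.finrank ℝ
    (LinearMap.ker S.B.mulVecLin ⊓ LinearMap.ker S.D.mulVecLin : Submodule ℝ (Fin m → ℝ))

end LinearSystem

/-!
Two different inputs with the same initial state and the same output have as difference a nonzero
solution of `x = J (A x + B u)`, `C x + D u = 0`, where `J` is the Volterra operator; integrating
once more, one may take it in `C(ℝ, ℝ)`. A nonzero polynomial in `J` is injective on `C(ℝ, ℝ)`, so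
this space is a torsion-free `ℝ[X]`-module with `X` acting as `J`. The components of the solution
span a finitely generated, hence free, submodule, and a linear functional on it turns the solution
into one over `ℝ[X]`. Applied to a high derivative of a bump function, this polynomial solution
becomes a nonzero input, supported in an arbitrarily short interval, that changes neither the output
nor the state outside that interval. If `u t` and `x t` were interior points of the constraint sets,
a small multiple of it could be added to `u` right after time `t`, and `y` would have two inputs. A
constant solution with values in `ker B ∩ ker D` does not move the state at all, so then it is
enough that `u t` is an interior point.
-/

open Polynomial Function
open scoped Matrix

theorem exists_finiteDimensional_mem_invtSubmodule {K V : Type*} [Field K] [AddCommGroup V]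
    [Module K V] (T : Module.End K V) {q : K[X]} (hq : q ≠ 0) {v : V} (hv : aeval T q v = 0) :
    ∃ W ∈ T.invtSubmodule, FiniteDimensional K W ∧ v ∈ W := by
  let orbit : K[X] →ₗ[K] V := LinearMap.applyₗ v ∘ₗ (aeval T).toLinearMap
  have orbit_mod (r : K[X]) : orbit (r % q) = orbit r := by
    conv_rhs => rw [← EuclideanDomain.mod_add_div r q, mul_comm]
    simp [orbit, hv]
  have hrange : LinearMap.range orbit = (degreeLT K q.natDegree).map orbit := by
    refine le_antisymm ?_ LinearMap.map_le_range
    rintro _ ⟨r, rfl⟩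
    refine ⟨r % q, mem_degreeLT.2 ?_, orbit_mod r⟩
    rw [← degree_eq_natDegree hq]
    exact EuclideanDomain.mod_lt r hq
  refine ⟨LinearMap.range orbit, ?_, ?_, 1, by simp [orbit]⟩
  · rw [Module.End.mem_invtSubmodule_iff_forall_mem_of_mem]
    rintro _ ⟨r, rfl⟩
    exact ⟨X * r, by simp [orbit]⟩
  · rw [hrange]
    have := Module.Finite.equiv (degreeLTEquiv K q.natDegree).symm
    infer_instance

theorem eq_zero_of_eq_integral {E : Type*} [NormedAddCommGroup E] [NormedSpace ℝ E]
    [CompleteSpace E] (L : E →L[ℝ] E) {g : ℝ → E} (hg : Continuous g)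
    (h : ∀ t, g t = ∫ s in (0 : ℝ)..t, L (g s)) : g = 0 := by
  have hLg : Continuous fun s => L (g s) := L.continuous.comp hg
  have hderiv (t : ℝ) : HasDerivAt g (L (g t)) t := by
    simpa only [← h] using (hLg.integral_hasStrictDerivAt 0 t).hasDerivAt
  exact ODE_solution_unique_univ (v := fun _ => L) (s := fun _ => univ) (t₀ := 0)
    (fun _ => L.lipschitz.lipschitzOnWith) (fun t => ⟨hderiv t, mem_univ _⟩)
    (fun t => ⟨by simp, mem_univ _⟩) (by simp [h 0])

/-- The Volterra operator `f ↦ ∫₀ᵗ f`. -/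
noncomputable def primitive : Module.End ℝ C(ℝ, ℝ) where
  toFun f := ⟨fun t => ∫ s in (0 : ℝ)..t, f s,
    intervalIntegral.continuous_primitive (fun a b => f.continuous.intervalIntegrable a b) 0⟩
  map_add' f g := ContinuousMap.ext fun t =>
    intervalIntegral.integral_add (f.continuous.intervalIntegrable 0 t)
      (g.continuous.intervalIntegrable 0 t)
  map_smul' c f := ContinuousMap.ext fun _ => intervalIntegral.integral_const_mul c f

theorem primitive_apply (f : C(ℝ, ℝ)) (t : ℝ) : primitive f t = ∫ s in (0 : ℝ)..t, f s := rfl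

theorem primitive_injective : Injective primitive := by
  refine (injective_iff_map_eq_zero _).2 fun f hf => ContinuousMap.ext fun t => ?_
  have hderiv : HasDerivAt (primitive f) (f t) t :=
    (f.continuous.integral_hasStrictDerivAt 0 t).hasDerivAt
  rw [hf] at hderiv
  exact hderiv.unique (hasDerivAt_const t (0 : ℝ))

theorem eq_bot_of_mem_invtSubmodule_primitive {W : Submodule ℝ C(ℝ, ℝ)}
    (hW : W ∈ primitive.invtSubmodule) [FiniteDimensional ℝ W] : W = ⊥ := by
  have hinj : Injective (primitive.restrict hW) := fun f g hfg =>
    Subtype.ext (primitive_injective (congrArg Subtype.val hfg))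
  -- The inverse of `primitive` on `W` is differentiation, so a basis of `W` solves a linear ODE
  -- with zero initial value.
  let D : W ≃ₗ[ℝ] W := (LinearEquiv.ofInjectiveEndo _ hinj).symm
  have primitive_D (f : W) : primitive (D f) = f :=
    congrArg Subtype.val ((LinearEquiv.ofInjectiveEndo _ hinj).apply_symm_apply f)
  let b := Module.finBasis ℝ W
  let M := LinearMap.toMatrix b b D
  let g : ℝ → Fin (Module.finrank ℝ W) → ℝ := fun t i => (b i : C(ℝ, ℝ)) t
  have hg : Continuous g := continuous_pi fun i => (b i : C(ℝ, ℝ)).continuous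
  let L := LinearMap.toContinuousLinearMap M.vecMulLinear
  have D_basis (i) (s : ℝ) : (D (b i) : C(ℝ, ℝ)) s = L (g s) i := by
    calc (D (b i) : C(ℝ, ℝ)) s = ((∑ j, M j i • b j : W) : C(ℝ, ℝ)) s := by
          simp only [M, LinearMap.toMatrix_apply, LinearEquiv.coe_coe, b.sum_repr]
      _ = L (g s) i := by
          simp [L, g, Matrix.vecMul, dotProduct, ContinuousMap.sum_apply, mul_comm]
  have hg0 : g = 0 := eq_zero_of_eq_integral L hg fun t => by
    ext i
    have hproj := (ContinuousLinearMap.proj (R := ℝ) (φ := fun _ => ℝ) i).intervalIntegral_comp_comm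
      ((L.continuous.comp hg).intervalIntegrable (μ := volume) 0 t)
    calc g t i = primitive (D (b i)) t := by rw [primitive_D]
      _ = ∫ s in (0 : ℝ)..t, L (g s) i := by simp only [primitive_apply, D_basis]
      _ = _ := hproj
  have hb (i) : b i = 0 := Subtype.ext (ContinuousMap.ext fun t => congrFun₂ hg0 t i)
  have : W.subtype = 0 := b.ext fun i => by simp [hb i]
  rw [← W.range_subtype, this, LinearMap.range_zero]

theorem eq_zero_of_aeval_primitive_eq_zero {q : ℝ[X]} (hq : q ≠ 0) {f : C(ℝ, ℝ)}
    (h : aeval primitive q f = 0) : f = 0 := by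
  obtain ⟨W, hW, _, hf⟩ := exists_finiteDimensional_mem_invtSubmodule primitive hq h
  rwa [eq_bot_of_mem_invtSubmodule_primitive hW] at hf

instance isTorsionFree_aeval_primitive : Module.IsTorsionFree ℝ[X] (Module.AEval' primitive) := by
  refine .of_smul_eq_zero fun q x hx => or_iff_not_imp_left.2 fun hq => ?_
  obtain ⟨f, rfl⟩ := (Module.AEval'.of primitive).surjective x
  have hf : aeval primitive q f = 0 := (Module.AEval'.of primitive).map_eq_zero_iff.1 hx
  rw [eq_zero_of_aeval_primitive_eq_zero hq hf, map_zero]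

theorem tsupport_iteratedDeriv_subset {E : Type*} [NormedAddCommGroup E] [NormedSpace ℝ E]
    (f : ℝ → E) (k : ℕ) : tsupport (iteratedDeriv k f) ⊆ tsupport f := by
  induction k with
  | zero => rw [iteratedDeriv_zero]
  | succ k ih => rw [iteratedDeriv_succ]; exact tsupport_deriv_subset.trans ih

theorem exists_support_aeval_primitive_subset {a b : ℝ} (ha : 0 ≤ a) (hab : a < b) (N : ℕ) :
    ∃ ψ : C(ℝ, ℝ), ψ ≠ 0 ∧
      ∀ q : ℝ[X], q.natDegree ≤ N → support (aeval primitive q ψ) ⊆ Ioo a b := by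
  obtain ⟨φ, hsupp, -, hφ, -, hφ1⟩ := exists_contDiff_tsupport_subset (n := ⊤)
    (Ioo_mem_nhds (show a < (a + b) / 2 by linarith) (show (a + b) / 2 < b by linarith))
  let D (k : ℕ) : C(ℝ, ℝ) := ⟨iteratedDeriv k φ, hφ.continuous_iteratedDeriv k (mod_cast le_top)⟩
  have support_D (k : ℕ) : support (D k) ⊆ Ioo a b :=
    subset_tsupport _ |>.trans (tsupport_iteratedDeriv_subset φ k) |>.trans hsupp
  have primitive_D (k : ℕ) : primitive (D (k + 1)) = D k := by
    ext t
    have hD0 : D k 0 = 0 := notMem_support.1 fun h0 => ha.not_gt (support_D k h0).1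
    have hderiv (s : ℝ) : HasDerivAt (D k) (D (k + 1) s) s := by
      simp only [D, ContinuousMap.coe_mk, iteratedDeriv_succ]
      exact (hφ.differentiable_iteratedDeriv k
        (mod_cast WithTop.coe_lt_top _)).differentiableAt.hasDerivAt
    rw [primitive_apply, intervalIntegral.integral_eq_sub_of_hasDerivAt (fun s _ => hderiv s)
      ((D (k + 1)).continuous.intervalIntegrable _ _), hD0, sub_zero]
  have primitive_pow_D (k j : ℕ) : (primitive ^ k) (D (j + k)) = D j := by
    induction k with
    | zero => rfl
    | succ k ih => rw [pow_succ, Module.End.mul_apply, ← add_assoc, primitive_D, ih]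
  refine ⟨D N, fun hN => ?_, fun q hq t ht => ?_⟩
  · have h0 : D 0 = 0 := by rw [← primitive_pow_D N 0, zero_add, hN, map_zero]
    simpa [D, hφ1] using DFunLike.congr_fun h0 ((a + b) / 2)
  · contrapose! ht
    rw [notMem_support, aeval_eq_sum_range, LinearMap.sum_apply, ContinuousMap.sum_apply]
    refine Finset.sum_eq_zero fun k hk => ?_
    obtain ⟨j, rfl⟩ := Nat.exists_eq_add_of_le' ((Finset.mem_range_succ_iff.1 hk).trans hq)
    simp [primitive_pow_D, notMem_support.1 fun h => ht (support_D j h)]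

namespace Signal

variable {k : ℕ} {f g : Signal k}

theorem continuousWithinAt_of_mem_continuitySet {t : ℝ} (ht : t ∈ f.continuitySet) :
    0 ≤ t ∧ ContinuousWithinAt f (Ici 0) t := by
  obtain ⟨_, ⟨⟨W, hW, rfl⟩, hf⟩, htW, ht0⟩ := ht
  exact ⟨ht0, (continuousWithinAt_inter' (mem_nhdsWithin_of_mem_nhds (hW.mem_nhds htW))).1
    (inter_comm W _ ▸ hf t ⟨htW, ht0⟩)⟩

theorem PiecewiseContinuous.add (hf : f.PiecewiseContinuous) (hg : g.PiecewiseContinuous) :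
    PiecewiseContinuous (f + g) := by
  refine ⟨fun T => ((hf.1 T).union (hg.1 T)).subset fun t ⟨ht, hfg⟩ => ?_, fun t ht => ?_,
    fun t ht => ?_⟩
  · by_contra h
    simp only [mem_union, mem_ofPred_eq, not_or, not_and, not_not] at h
    exact hfg ((h.1 ht).add (h.2 ht))
  · obtain ⟨l, hl⟩ := hf.2.1 t ht
    obtain ⟨l', hl'⟩ := hg.2.1 t ht
    exact ⟨l + l', hl.add hl'⟩
  · obtain ⟨l, hl⟩ := hf.2.2 t ht
    obtain ⟨l', hl'⟩ := hg.2.2 t ht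
    exact ⟨l + l', hl.add hl'⟩

theorem piecewiseContinuous_of_continuous (hf : Continuous f) : f.PiecewiseContinuous :=
  ⟨fun T => by simp [hf.continuousWithinAt],
    fun t _ => ⟨f t, hf.tendsto t |>.mono_left inf_le_left⟩,
    fun t _ => ⟨f t, hf.tendsto t |>.mono_left inf_le_left⟩⟩

theorem ExpBounded.add (hf : f.ExpBounded) (hg : g.ExpBounded) : ExpBounded (f + g) := by
  obtain ⟨M, a, hM⟩ := hf
  obtain ⟨N, b, hN⟩ := hg
  refine ⟨|M| + |N|, max a b, fun t ht => ?_⟩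
  calc ‖f t + g t‖ ≤ ‖f t‖ + ‖g t‖ := norm_add_le _ _
    _ ≤ |M| * Real.exp (a * t) + |N| * Real.exp (b * t) := by
        gcongr
        · exact (hM t ht).trans (by gcongr; exact le_abs_self M)
        · exact (hN t ht).trans (by gcongr; exact le_abs_self N)
    _ ≤ |M| * Real.exp (max a b * t) + |N| * Real.exp (max a b * t) := by
        gcongr
        · exact le_max_left a b
        · exact le_max_right a b
    _ = (|M| + |N|) * Real.exp (max a b * t) := (add_mul _ _ _).symm

theorem add_mem_freeInputs (hf : f ∈ freeInputs k) (hg : g ∈ freeInputs k) :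
    f + g ∈ freeInputs k :=
  ⟨fun t ht => by simp [hf.1 t ht, hg.1 t ht], hf.2.1.add hg.2.1, hf.2.2.add hg.2.2⟩

theorem mem_freeInputs_of_continuous (hf : Continuous f) {a b : ℝ} (ha : 0 ≤ a)
    (hfs : support f ⊆ Ioo a b) : f ∈ freeInputs k := by
  obtain ⟨M, hM⟩ := hf.bounded_above_of_compact_support
    (.of_support_subset_isCompact isCompact_Icc (hfs.trans Ioo_subset_Icc_self))
  exact ⟨fun t ht => notMem_support.1 fun h => (ht.trans_le ha).not_gt (hfs h).1,
    piecewiseContinuous_of_continuous hf, M, 0, by simpa using fun t _ => hM t⟩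

theorem PiecewiseContinuous.aestronglyMeasurable (hf : f.PiecewiseContinuous) :
    AEStronglyMeasurable f (volume.restrict (Ici 0)) := by
  set discont := {t | t ∈ Ici (0 : ℝ) ∧ ¬ ContinuousWithinAt f (Ici 0) t}
  have hcountable : discont.Countable := by
    refine (countable_iUnion fun N : ℕ => (hf.1 N).countable).mono fun t ht => ?_
    obtain ⟨N, hN⟩ := exists_nat_ge t
    exact mem_iUnion.2 ⟨N, ⟨ht.1, hN⟩, ht.2⟩
  have hcont : ContinuousOn f (Ici 0 \ discont) := fun t ht =>
    (not_not.1 fun h => ht.2 ⟨ht.1, h⟩).mono sdiff_subset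
  rw [← Measure.restrict_congr_set (sdiff_null_ae_eq_self (hcountable.measure_zero volume))]
  exact hcont.aestronglyMeasurable (measurableSet_Ici.diff hcountable.measurableSet)

theorem locallyIntegrable_of_mem_freeInputs (hf : f ∈ freeInputs k) : LocallyIntegrable f := by
  obtain ⟨hcausal, hpc, M, a, hM⟩ := hf
  have hM0 : 0 ≤ M := (norm_nonneg _).trans (by simpa using hM 0 le_rfl)
  have hfi : (Ici 0).indicator f = f := indicator_eq_self.2 fun t ht =>
    not_lt.1 fun h => ht (hcausal t h)
  have hmeas : AEStronglyMeasurable f := by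
    rw [← hfi]
    exact (aestronglyMeasurable_indicator_iff measurableSet_Ici).2 hpc.aestronglyMeasurable
  have hexp : Continuous fun t : ℝ => M * Real.exp (a * t) := by fun_prop
  refine hexp.locallyIntegrable.mono hmeas (.of_forall fun t => ?_)
  rw [Real.norm_of_nonneg (by positivity)]
  rcases lt_or_ge t 0 with ht | ht
  · rw [hcausal t ht, norm_zero]
    positivity
  · exact hM t ht

theorem AEEq.ae_eq_of_causal (hf : f.Causal) (hg : g.Causal) (h : f.AEEq g) : f =ᵐ[volume] g := by
  filter_upwards [(ae_restrict_iff' measurableSet_Ici).1 h] with t ht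
  rcases lt_or_ge t 0 with ht0 | ht0
  · rw [hf t ht0, hg t ht0]
  · exact ht ht0

theorem not_aeEq_add (hf : f.Causal) (hg : g.Causal) (hgc : Continuous g) (hg0 : g ≠ 0) :
    ¬ f.AEEq (f + g) := by
  intro h
  have hfg : f =ᵐ[volume] f + g :=
    h.ae_eq_of_causal hf fun t ht => by simp [hf t ht, hg t ht]
  have hg_ae : g =ᵐ[volume] 0 := hfg.mono fun t ht => by simpa using ht
  exact hg0 ((hgc.ae_eq_iff_eq volume continuous_zero).1 hg_ae)

theorem eventually_forall_add_smul_mem {V : Set (Fin k → ℝ)} (hfV : ∀ s, 0 ≤ s → f s ∈ V) {t : ℝ}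
    (hf : ContinuousWithinAt f (Ici 0) t) (ht : 0 ≤ t) (hV : f t ∈ interior V) :
    ∀ᶠ b in 𝓝[>] t, ∀ w : Signal k, Continuous w → support w ⊆ Ioo t b →
      ∀ᶠ ε in 𝓝 (0 : ℝ), ∀ s, 0 ≤ s → f s + ε • w s ∈ V := by
  have hright : ContinuousWithinAt f (Ioi t) t := hf.mono fun s hs => ht.trans (le_of_lt hs)
  have hadd : Tendsto (fun q : ℝ × (Fin k → ℝ) => f q.1 + q.2) (𝓝[>] t ×ˢ 𝓝 0) (𝓝 (f t)) := by
    simpa using (hright.tendsto.comp tendsto_fst).add (tendsto_snd (g := 𝓝 (0 : Fin k → ℝ)))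
  obtain ⟨near, hnear, small, hsmall, hmem⟩ := eventually_prod_iff.1
    (hadd.eventually (mem_interior_iff_mem_nhds.1 hV))
  obtain ⟨c, hc, hcnear⟩ := mem_nhdsGT_iff_exists_Ioo_subset.1 hnear
  filter_upwards [Ioc_mem_nhdsGT hc] with b hb w hw hws
  have hbdd : Bornology.IsVonNBounded ℝ (range w) := NormedSpace.isVonNBounded_of_isBounded ℝ
    (isCompact_range_of_support_subset_isCompact hw isCompact_Icc
      (hws.trans Ioo_subset_Icc_self)).isBounded
  filter_upwards [(hbdd hsmall).eventually_nhds_zero (mem_of_mem_nhds hsmall)] with ε hε s hs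
  by_cases hsw : s ∈ support w
  · exact hmem (hcnear (Ioo_subset_Ioo_right hb.2 (hws hsw))) (hε (mem_range_self s))
  · rw [notMem_support.1 hsw, smul_zero, add_zero]
    exact hfV s hs

end Signal

namespace LinearSystem

variable {m n p : ℕ} {S : LinearSystem m n p}

/-- Solutions of the state equation from the zero state, with zero output, where signals are vectors
over an arbitrary module and an arbitrary endomorphism `J` plays the role of integration. -/
structure IsOutputNulling {M : Type*} [AddCommGroup M] [Module ℝ M] (S : LinearSystem m n p)
    (J : Module.End ℝ M) (ξ : Fin n → M) (ω : Fin m → M) : Prop where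
  state : ∀ i, ξ i = J (∑ j, S.A i j • ξ j + ∑ j, S.B i j • ω j)
  output : ∀ i, ∑ j, S.C i j • ξ j + ∑ j, S.D i j • ω j = 0

namespace IsOutputNulling

variable {M N : Type*} [AddCommGroup M] [Module ℝ M] [AddCommGroup N] [Module ℝ N]
  {J : Module.End ℝ M} {K : Module.End ℝ N} {ξ : Fin n → M} {ω : Fin m → M}

theorem map (h : S.IsOutputNulling J ξ ω) {φ : M →ₗ[ℝ] N} (hφ : ∀ v, φ (J v) = K (φ v)) :
    S.IsOutputNulling K (φ ∘ ξ) (φ ∘ ω) where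
  state i := by simpa [hφ] using congrArg φ (h.state i)
  output i := by simpa using congrArg φ (h.output i)

theorem of_map {φ : M →ₗ[ℝ] N} (h : S.IsOutputNulling K (φ ∘ ξ) (φ ∘ ω)) (hinj : Injective φ)
    (hφ : ∀ v, φ (J v) = K (φ v)) : S.IsOutputNulling J ξ ω where
  state i := hinj (by simpa [hφ] using h.state i)
  output i := hinj (by simpa using h.output i)

theorem exists_polynomial [Module.IsTorsionFree ℝ[X] (Module.AEval' J)]
    (h : S.IsOutputNulling J ξ ω) (hω : ω ≠ 0) :
    ∃ (ξ' : Fin n → ℝ[X]) (ω' : Fin m → ℝ[X]),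
      S.IsOutputNulling (LinearMap.mulLeft ℝ (X : ℝ[X])) ξ' ω' ∧ ω' ≠ 0 := by
  obtain ⟨k, hk⟩ := ne_iff.1 hω
  let e := Module.AEval'.of J
  have h_e : S.IsOutputNulling (Algebra.lsmul ℝ ℝ (Module.AEval' J) (X : ℝ[X])) (e ∘ ξ) (e ∘ ω) :=
    h.map (φ := e.toLinearMap) fun v => (Module.AEval'.X_smul_of J v).symm
  let W := Submodule.span ℝ[X] (range (e ∘ ξ) ∪ range (e ∘ ω))
  have : Module.Finite ℝ[X] W :=
    .span_of_finite _ ((finite_range _).union (finite_range _))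
  let ξW (i : Fin n) : W := ⟨e (ξ i), Submodule.subset_span (.inl (mem_range_self i))⟩
  let ωW (j : Fin m) : W := ⟨e (ω j), Submodule.subset_span (.inr (mem_range_self j))⟩
  have hW : S.IsOutputNulling (Algebra.lsmul ℝ ℝ W (X : ℝ[X])) ξW ωW :=
    of_map (φ := W.subtype.restrictScalars ℝ) h_e Subtype.val_injective fun _ => rfl
  have hωW : ωW k ≠ 0 := fun h0 => hk (e.map_eq_zero_iff.1 (congrArg Subtype.val h0))
  obtain ⟨f, hf⟩ : ∃ f : Module.Dual ℝ[X] W, f (ωW k) ≠ 0 := by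
    simpa using mt (Module.forall_dual_apply_eq_zero_iff ℝ[X] (ωW k)).1 hωW
  exact ⟨_, _, hW.map (φ := f.restrictScalars ℝ) fun v => f.map_smul X v,
    fun h0 => hf (congrFun h0 k)⟩

end IsOutputNulling

theorem exists_isOutputNulling_of_rho_pos (hρ : 0 < S.rho) :
    ∃ ω : Fin m → ℝ[X], S.IsOutputNulling (LinearMap.mulLeft ℝ (X : ℝ[X])) 0 ω ∧ ω ≠ 0 := by
  have := Module.finrank_pos_iff.1 hρ
  obtain ⟨⟨v, hB, hD⟩, hv⟩ := exists_ne
    (0 : (LinearMap.ker S.B.mulVecLin ⊓ LinearMap.ker S.D.mulVecLin : Submodule ℝ (Fin m → ℝ)))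
  have sum_smul_C {l : ℕ} {Q : Matrix (Fin l) (Fin m) ℝ} (hQ : Q *ᵥ v = 0) (i : Fin l) :
      ∑ j, Q i j • Polynomial.C (v j) = 0 := by
    simp only [smul_C, smul_eq_mul, ← map_sum]
    exact (congrArg Polynomial.C (congrFun hQ i)).trans C_0
  refine ⟨fun j => Polynomial.C (v j), ⟨fun i => ?_, fun i => ?_⟩,
    fun h0 => hv (Subtype.ext (funext fun j => ?_))⟩
  · simp only [Pi.zero_apply, smul_zero, Finset.sum_const_zero, zero_add, sum_smul_C hB, map_zero]
  · simp only [Pi.zero_apply, smul_zero, Finset.sum_const_zero, zero_add, sum_smul_C hD]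
  · exact C_eq_zero.1 (congrFun h0 j)

end LinearSystem

section Integral

variable {ι κ ν : Type*} [Fintype ι] [Fintype κ] [Fintype ν]

theorem intervalIntegrable_mulVec (P : Matrix ν ι ℝ) {f : ℝ → ι → ℝ} {a b : ℝ}
    (hf : IntervalIntegrable f volume a b) :
    IntervalIntegrable (fun s => P *ᵥ f s) volume a b :=
  ⟨P.mulVecLin.toContinuousLinearMap.integrable_comp hf.1,
    P.mulVecLin.toContinuousLinearMap.integrable_comp hf.2⟩

theorem integral_mulVec (P : Matrix ν ι ℝ) {f : ℝ → ι → ℝ} {a b : ℝ}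
    (hf : IntervalIntegrable f volume a b) :
    ∫ s in a..b, P *ᵥ f s = P *ᵥ ∫ s in a..b, f s :=
  P.mulVecLin.toContinuousLinearMap.intervalIntegral_comp_comm hf

theorem integral_mulVec_add_mulVec (P : Matrix ν ι ℝ) (Q : Matrix ν κ ℝ)
    {f : ℝ → ι → ℝ} {g : ℝ → κ → ℝ} {a b : ℝ} (hf : IntervalIntegrable f volume a b)
    (hg : IntervalIntegrable g volume a b) :
    ∫ s in a..b, (P *ᵥ f s + Q *ᵥ g s) = P *ᵥ (∫ s in a..b, f s) + Q *ᵥ ∫ s in a..b, g s := by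
  rw [intervalIntegral.integral_add (intervalIntegrable_mulVec P hf)
    (intervalIntegrable_mulVec Q hg), integral_mulVec P hf, integral_mulVec Q hg]

theorem intervalIntegral_apply {f : ℝ → ι → ℝ} {a b : ℝ} (hf : IntervalIntegrable f volume a b)
    (i : ι) : (∫ s in a..b, f s) i = ∫ s in a..b, f s i :=
  ((ContinuousLinearMap.proj (R := ℝ) (φ := fun _ => ℝ) i).intervalIntegral_comp_comm hf).symm

theorem ae_eq_zero_of_forall_integral_eq_zero {E : Type*} [NormedAddCommGroup E] [NormedSpace ℝ E]
    [CompleteSpace E] {f : ℝ → E} (hf : LocallyIntegrable f)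
    (h : ∀ t, ∫ s in (0 : ℝ)..t, f s = 0) : f =ᵐ[volume] 0 := by
  filter_upwards [LocallyIntegrable.ae_hasDerivAt_integral hf] with t ht
  have hderiv := ht 0
  simp only [h] at hderiv
  exact hderiv.unique (hasDerivAt_const t 0)

end Integral

namespace LinearSystem

variable {m n p : ℕ} {S : LinearSystem m n p}

theorem isOutputNulling_primitive_iff {v : Fin n → C(ℝ, ℝ)} {ω : Fin m → C(ℝ, ℝ)} :
    S.IsOutputNulling primitive v ω ↔
      (∀ t, (fun i => v i t) =
        ∫ s in (0 : ℝ)..t, (S.A *ᵥ (fun i => v i s) + S.B *ᵥ fun j => ω j s)) ∧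
      ∀ t, S.C *ᵥ (fun i => v i t) + S.D *ᵥ (fun j => ω j t) = 0 := by
  have hv : Continuous fun t i => v i t := continuous_pi fun i => (v i).continuous
  have hω : Continuous fun t j => ω j t := continuous_pi fun j => (ω j).continuous
  have combination_apply {l : ℕ} (P : Matrix (Fin l) (Fin n) ℝ) (Q : Matrix (Fin l) (Fin m) ℝ)
      (i : Fin l) (t : ℝ) : (∑ j, P i j • v j + ∑ j, Q i j • ω j) t =
        (P *ᵥ (fun j => v j t) + Q *ᵥ fun j => ω j t) i := by
    simp [Matrix.mulVec, dotProduct, ContinuousMap.sum_apply]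
  have primitive_combination (i : Fin n) (t : ℝ) :
      primitive (∑ j, S.A i j • v j + ∑ j, S.B i j • ω j) t =
        (∫ s in (0 : ℝ)..t, (S.A *ᵥ (fun i => v i s) + S.B *ᵥ fun j => ω j s)) i := by
    rw [intervalIntegral_apply ((intervalIntegrable_mulVec S.A (hv.intervalIntegrable 0 t)).add
      (intervalIntegrable_mulVec S.B (hω.intervalIntegrable 0 t))), primitive_apply]
    simp only [combination_apply]
  constructor
  · exact fun h => ⟨fun t => funext fun i =>
      (DFunLike.congr_fun (h.state i) t).trans (primitive_combination i t),
      fun t => funext fun i =>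
        (combination_apply S.C S.D i t).symm.trans (DFunLike.congr_fun (h.output i) t)⟩
  · exact fun ⟨hstate, houtput⟩ => ⟨fun i => ContinuousMap.ext fun t =>
      (congrFun (hstate t) i).trans (primitive_combination i t).symm,
      fun i => ContinuousMap.ext fun t =>
        (combination_apply S.C S.D i t).trans (congrFun (houtput t) i)⟩

/-- `z` is the state of the system `S` driven by the input `w` from the zero state, in integrated
form and, unlike in `LinearSystem.IsStateTrajectory`, on the whole time axis. -/
structure IsZeroStateResponse (S : LinearSystem m n p) (w : Signal m) (z : Signal n) : Prop where
  locallyIntegrable : LocallyIntegrable w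
  continuous : Continuous z
  eq_integral : ∀ t, z t = ∫ s in (0 : ℝ)..t, (S.A *ᵥ z s + S.B *ᵥ w s)

/-- Zero state responses to inputs that leave no trace in the output. -/
structure IsInvisible (S : LinearSystem m n p) (w : Signal m) (z : Signal n) : Prop
    extends S.IsZeroStateResponse w z where
  output : ∀ᵐ t, S.C *ᵥ z t + S.D *ᵥ w t = 0

variable {w : Signal m} {z : Signal n}

theorem IsZeroStateResponse.eq_zero (h : S.IsZeroStateResponse w z) (hw : w =ᵐ[volume] 0) :
    z = 0 := by
  refine eq_zero_of_eq_integral S.A.mulVecLin.toContinuousLinearMap h.continuous fun t => ?_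
  rw [h.eq_integral t]
  refine intervalIntegral.integral_congr_ae (hw.mono fun s hs _ => ?_)
  simp [hs]

theorem IsInvisible.exists_isOutputNulling (h : S.IsInvisible w z) (hw : ¬ w =ᵐ[volume] 0) :
    ∃ (ξ : Fin n → C(ℝ, ℝ)) (ω : Fin m → C(ℝ, ℝ)), S.IsOutputNulling primitive ξ ω ∧ ω ≠ 0 := by
  have hwi (a b : ℝ) : IntervalIntegrable w volume a b :=
    (h.locallyIntegrable.integrableOn_isCompact isCompact_uIcc).intervalIntegrable
  have hzi (a b : ℝ) : IntervalIntegrable z volume a b := h.continuous.intervalIntegrable a b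
  have hZ : Continuous fun t => ∫ s in (0 : ℝ)..t, z s :=
    intervalIntegral.continuous_primitive hzi 0
  have hW : Continuous fun t => ∫ s in (0 : ℝ)..t, w s :=
    intervalIntegral.continuous_primitive hwi 0
  -- The antiderivatives of `z` and `w` solve the same equations, and both are continuous.
  refine ⟨fun i => ⟨_, (continuous_apply i).comp hZ⟩, fun j => ⟨_, (continuous_apply j).comp hW⟩,
    isOutputNulling_primitive_iff.2 ⟨fun t => ?_, fun t => ?_⟩, fun h0 => hw ?_⟩
  · simp only [ContinuousMap.coe_mk, comp_apply,
      ← integral_mulVec_add_mulVec _ _ (hzi _ _) (hwi _ _), ← h.eq_integral]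
  · simp only [ContinuousMap.coe_mk, comp_apply,
      ← integral_mulVec_add_mulVec _ _ (hzi _ _) (hwi _ _)]
    exact intervalIntegral.integral_zero_ae (h.output.mono fun s hs _ => hs)
  · exact ae_eq_zero_of_forall_integral_eq_zero h.locallyIntegrable fun t =>
      funext fun j => DFunLike.congr_fun (congrFun h0 j) t

theorem IsOutputNulling.exists_isInvisible {ξ : Fin n → ℝ[X]} {ω : Fin m → ℝ[X]}
    (h : S.IsOutputNulling (LinearMap.mulLeft ℝ (X : ℝ[X])) ξ ω) (hω : ω ≠ 0) {a b : ℝ}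
    (ha : 0 ≤ a) (hab : a < b) :
    ∃ (w : Signal m) (z : Signal n), S.IsInvisible w z ∧ w ≠ 0 ∧ Continuous w ∧
      support w ⊆ Ioo a b ∧ support z ⊆ Ioo a b ∧ (ξ = 0 → z = 0) := by
  obtain ⟨j, hj⟩ := ne_iff.1 hω
  obtain ⟨ψ, hψ, hsupp⟩ := exists_support_aeval_primitive_subset ha hab
    (Finset.univ.sup (fun i => (ξ i).natDegree) ⊔ Finset.univ.sup fun j => (ω j).natDegree)
  let φ : ℝ[X] →ₗ[ℝ] C(ℝ, ℝ) := LinearMap.applyₗ ψ ∘ₗ (aeval primitive).toLinearMap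
  have hφ : S.IsOutputNulling primitive (φ ∘ ξ) (φ ∘ ω) := h.map fun q => by simp [φ]
  obtain ⟨hstate, houtput⟩ := isOutputNulling_primitive_iff.1 hφ
  have support_subset {l : ℕ} {q : Fin l → ℝ[X]}
      (hq : ∀ i, support (φ (q i)) ⊆ Ioo a b) : support (fun t i => φ (q i) t) ⊆ Ioo a b :=
    fun t ht => (ne_iff.1 ht).elim fun i hi => hq i hi
  have hw : Continuous fun t j => φ (ω j) t := continuous_pi fun j => (φ (ω j)).continuous
  refine ⟨fun t j => φ (ω j) t, fun t i => φ (ξ i) t,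
    ⟨⟨hw.locallyIntegrable, continuous_pi fun i => (φ (ξ i)).continuous, hstate⟩,
      .of_forall houtput⟩, fun h0 => hψ ?_, hw, ?_, ?_, fun h0 => ?_⟩
  · exact eq_zero_of_aeval_primitive_eq_zero hj (ContinuousMap.ext fun t => congrFun₂ h0 t j)
  · exact support_subset fun j => hsupp _
      (le_sup_of_le_right (Finset.le_sup (f := fun j => (ω j).natDegree) (Finset.mem_univ j)))
  · exact support_subset fun i => hsupp _
      (le_sup_of_le_left (Finset.le_sup (f := fun i => (ξ i).natDegree) (Finset.mem_univ i)))
  · ext t i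
    simp [h0]

theorem IsInvisible.const_smul (h : S.IsInvisible w z) (c : ℝ) : S.IsInvisible (c • w) (c • z) where
  locallyIntegrable := h.locallyIntegrable.smul c
  continuous := h.continuous.const_smul c
  eq_integral t := by
    simp only [Pi.smul_apply, Matrix.mulVec_smul, ← smul_add, intervalIntegral.integral_smul,
      ← h.eq_integral]
  output := by
    filter_upwards [h.output] with t ht
    simp only [Pi.smul_apply, Matrix.mulVec_smul, ← smul_add, ht, smul_zero]

variable {x₀ : Fin n → ℝ} {u u₁ u₂ : Signal m} {x x₁ x₂ : Signal n} {y y₁ y₂ : Signal p}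

theorem IsStateTrajectory.intervalIntegrable (hu : u ∈ freeInputs m)
    (hx : S.IsStateTrajectory x₀ u x) {t : ℝ} (ht : 0 ≤ t) :
    IntervalIntegrable (fun s => S.A *ᵥ x s + S.B *ᵥ u s) volume 0 t := by
  have hxc : ContinuousOn x (uIcc 0 t) := hx.1.mono fun s hs => by
    rw [uIcc_of_le ht] at hs
    exact hs.1
  have hui := (Signal.locallyIntegrable_of_mem_freeInputs hu).integrableOn_isCompact
    (isCompact_uIcc (a := 0) (b := t))
  exact (intervalIntegrable_mulVec S.A hxc.intervalIntegrable).add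
    (intervalIntegrable_mulVec S.B hui.intervalIntegrable)

theorem IsStateTrajectory.add (hu : u ∈ freeInputs m) (hx : S.IsStateTrajectory x₀ u x)
    (h : S.IsZeroStateResponse w z) : S.IsStateTrajectory x₀ (u + w) (x + z) := by
  refine ⟨hx.1.add h.continuous.continuousOn, fun t ht => ?_⟩
  have hwi := h.locallyIntegrable.integrableOn_isCompact (isCompact_uIcc (a := 0) (b := t))
  have hzw := (intervalIntegrable_mulVec S.A (h.continuous.intervalIntegrable 0 t)).add
    (intervalIntegrable_mulVec S.B hwi.intervalIntegrable)
  calc x t + z t = x₀ + ((∫ s in (0 : ℝ)..t, (S.A *ᵥ x s + S.B *ᵥ u s)) +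
        ∫ s in (0 : ℝ)..t, (S.A *ᵥ z s + S.B *ᵥ w s)) := by
        rw [hx.2 t ht, h.eq_integral t, add_assoc]
    _ = x₀ + ∫ s in (0 : ℝ)..t, (S.A *ᵥ (x + z) s + S.B *ᵥ (u + w) s) := by
        rw [← intervalIntegral.integral_add (hx.intervalIntegrable hu ht) hzw]
        simp only [Pi.add_apply, Matrix.mulVec_add, add_add_add_comm]

theorem IsStateTrajectory.apply_zero (hx : S.IsStateTrajectory x₀ u x) : x 0 = x₀ := by
  simpa using hx.2 0 le_rfl

theorem IsStateTrajectory.sub (hu₁ : u₁ ∈ freeInputs m) (hu₂ : u₂ ∈ freeInputs m)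
    (hx₁ : S.IsStateTrajectory x₀ u₁ x₁) (hx₂ : S.IsStateTrajectory x₀ u₂ x₂) :
    S.IsZeroStateResponse (u₁ - u₂) (fun t => (x₁ - x₂) (max t 0)) where
  locallyIntegrable := (Signal.locallyIntegrable_of_mem_freeInputs hu₁).sub
    (Signal.locallyIntegrable_of_mem_freeInputs hu₂)
  continuous := (hx₁.1.sub hx₂.1).comp_continuous (by fun_prop) fun t => le_max_right t 0
  eq_integral t := by
    rcases le_total 0 t with ht | ht
    · calc (x₁ - x₂) (max t 0) = ∫ s in (0 : ℝ)..t,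
            ((S.A *ᵥ x₁ s + S.B *ᵥ u₁ s) - (S.A *ᵥ x₂ s + S.B *ᵥ u₂ s)) := by
            rw [max_eq_left ht, Pi.sub_apply, hx₁.2 t ht, hx₂.2 t ht, add_sub_add_left_eq_sub,
              intervalIntegral.integral_sub (hx₁.intervalIntegrable hu₁ ht)
                (hx₂.intervalIntegrable hu₂ ht)]
        _ = _ := intervalIntegral.integral_congr fun s hs => by
            rw [uIcc_of_le ht] at hs
            simp only [max_eq_left hs.1, Pi.sub_apply, Matrix.mulVec_sub, add_sub_add_comm]
    · have h0 : (x₁ - x₂) 0 = 0 := by rw [Pi.sub_apply, hx₁.apply_zero, hx₂.apply_zero, sub_self]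
      rw [max_eq_right ht, h0, eq_comm]
      refine intervalIntegral.integral_zero_ae ?_
      filter_upwards [Measure.ae_ne volume 0] with s hs0 hs
      have hs : s < 0 := (uIoc_of_ge ht ▸ hs).2.lt_of_ne hs0
      simp [max_eq_right hs.le, h0, hu₁.1 s hs, hu₂.1 s hs]

theorem IsStateTrajectory.eqOn (hu₁ : u₁ ∈ freeInputs m) (hu₂ : u₂ ∈ freeInputs m)
    (hx₁ : S.IsStateTrajectory x₀ u₁ x₁) (hx₂ : S.IsStateTrajectory x₀ u₂ x₂)
    (hu : u₁.AEEq u₂) : EqOn x₁ x₂ (Ici 0) := by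
  have hw : u₁ - u₂ =ᵐ[volume] 0 := (sub_ae_eq_zero _ _).2 (hu.ae_eq_of_causal hu₁.1 hu₂.1)
  intro t ht
  simpa [max_eq_left (mem_Ici.1 ht), sub_eq_zero] using
    congrFun ((hx₁.sub hu₁ hu₂ hx₂).eq_zero hw) t

theorem isInvisible_sub (h₁ : (u₁, x₁, y₁) ∈ S.freeTriples x₀)
    (h₂ : (u₂, x₂, y₂) ∈ S.freeTriples x₀) (hy : y₁.AEEq y₂) :
    S.IsInvisible (u₁ - u₂) (fun t => (x₁ - x₂) (max t 0)) := by
  obtain ⟨hu₁ : u₁ ∈ freeInputs m, hx₁ : S.IsStateTrajectory x₀ u₁ x₁, hy₁⟩ := h₁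
  obtain ⟨hu₂ : u₂ ∈ freeInputs m, hx₂ : S.IsStateTrajectory x₀ u₂ x₂, hy₂⟩ := h₂
  refine ⟨hx₁.sub hu₁ hu₂ hx₂, ?_⟩
  filter_upwards [(ae_restrict_iff' measurableSet_Ici).1 ((hy₁.symm.trans hy).trans hy₂)] with t ht
  rcases lt_or_ge t 0 with ht0 | ht0
  · simp [max_eq_right ht0.le, hx₁.apply_zero, hx₂.apply_zero, hu₁.1 t ht0, hu₂.1 t ht0]
  · simp only [max_eq_left ht0, Pi.sub_apply, Matrix.mulVec_sub]
    rw [sub_add_sub_comm, ht ht0, sub_self]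

theorem IsInputRedundant.exists_isOutputNulling (hS : S.IsInputRedundant univ univ) :
    ∃ (ξ : Fin n → ℝ[X]) (ω : Fin m → ℝ[X]),
      S.IsOutputNulling (LinearMap.mulLeft ℝ (X : ℝ[X])) ξ ω ∧ ω ≠ 0 := by
  obtain ⟨_, -, u₁, y₁, u₂, y₂, ⟨x₁, h₁, -⟩, ⟨x₂, h₂, -⟩, hne, hy, -⟩ := hS
  have hw : ¬ u₁ - u₂ =ᵐ[volume] 0 := fun h0 => hne (ae_restrict_of_ae ((sub_ae_eq_zero _ _).1 h0))
  obtain ⟨ξ, ω, h, hω⟩ := (isInvisible_sub h₁ h₂ hy).exists_isOutputNulling hw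
  exact h.exists_polynomial hω

variable {U : Set (Fin m → ℝ)} {X : Set (Fin n → ℝ)}

theorem add_mem_triples (h : (u, x, y) ∈ S.triples U X x₀) (hwz : S.IsInvisible w z)
    (hw : w ∈ freeInputs m) (hU : ∀ t, 0 ≤ t → u t + w t ∈ U) (hX : ∀ t, 0 ≤ t → x t + z t ∈ X) :
    (u + w, x + z, y) ∈ S.triples U X x₀ := by
  obtain ⟨⟨hu, hx, hy⟩, -, -, hyo⟩ := h
  have huw : u + w ∈ freeInputs m := Signal.add_mem_freeInputs hu hw
  have hxz : S.IsStateTrajectory x₀ (u + w) (x + z) := hx.add hu hwz.toIsZeroStateResponse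
  refine ⟨⟨huw, hxz, ?_⟩, ⟨hU, huw⟩, ⟨hX, hxz.1⟩, hyo⟩
  filter_upwards [hy, ae_restrict_of_ae hwz.output] with t hyt hwzt
  simp only [Pi.add_apply, Matrix.mulVec_add]
  rw [add_add_add_comm, hwzt, add_zero, hyt]

theorem exists_triples_ne (hq : (u, x, y) ∈ S.triples U X x₀) {ξ : Fin n → ℝ[X]}
    {ω : Fin m → ℝ[X]} (h : S.IsOutputNulling (LinearMap.mulLeft ℝ (Polynomial.X : ℝ[X])) ξ ω)
    (hω : ω ≠ 0) {t : ℝ} (ht : t ∈ u.continuitySet) (hU : u t ∈ interior U)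
    (hX : ξ = 0 ∨ x t ∈ interior X) :
    ∃ (u' : Signal m) (x' : Signal n), (u', x', y) ∈ S.triples U X x₀ ∧ ¬ u.AEEq u' := by
  have ⟨⟨hu, hx, _⟩, ⟨huU, _⟩, ⟨hxX, _⟩, _⟩ := hq
  obtain ⟨ht0, hut⟩ := Signal.continuousWithinAt_of_mem_continuitySet ht
  have state_margin : ∀ᶠ b in 𝓝[>] t, ∀ z : Signal n, Continuous z → support z ⊆ Ioo t b →
      (ξ = 0 → z = 0) → ∀ᶠ ε in 𝓝 (0 : ℝ), ∀ s, 0 ≤ s → x s + ε • z s ∈ X := by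
    rcases hX with hξ | hX
    · refine .of_forall fun b z _ _ hz => .of_forall fun ε s hs => ?_
      simpa [hz hξ] using hxX s hs
    · exact (Signal.eventually_forall_add_smul_mem hxX (hx.1 t ht0) ht0 hX).mono
        fun b hb z hz hzs _ => hb z hz hzs
  obtain ⟨b, ⟨hbU, hbX⟩, hb : t < b⟩ :=
    ((Signal.eventually_forall_add_smul_mem huU hut ht0 hU).and state_margin).and
      self_mem_nhdsWithin |>.exists
  obtain ⟨w, z, hwz, hw0, hw, hws, hzs, hz0⟩ := h.exists_isInvisible hω ht0 hb
  obtain ⟨ε, ⟨hεU, hεX⟩, hε : ε ≠ 0⟩ :=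
    (((hbU w hw hws).and (hbX z hwz.continuous hzs hz0)).filter_mono
      nhdsWithin_le_nhds).and self_mem_nhdsWithin |>.exists (f := 𝓝[≠] (0 : ℝ))
  have hεw : ε • w ∈ freeInputs m := Signal.mem_freeInputs_of_continuous (hw.const_smul ε) ht0
    ((support_const_smul_subset ε w).trans hws)
  exact ⟨_, _, add_mem_triples hq (hwz.const_smul ε) hεw hεU hεX,
    Signal.not_aeEq_add hu.1 hεw.1 (hw.const_smul ε) (smul_ne_zero hε hw0)⟩

theorem aeEq_of_notMem_redundantPairs (hy : (x₀, y) ∈ X ×ˢ outputs p)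
    (hnot : (x₀, y) ∉ S.redundantPairs U X) (h₁ : (u₁, x₁, y) ∈ S.triples U X x₀)
    (h₂ : (u₂, x₂, y) ∈ S.triples U X x₀) : u₁.AEEq u₂ := by
  by_contra hne
  exact hnot ⟨hy, u₁, y, u₂, y, ⟨x₁, h₁⟩, ⟨x₂, h₂⟩, hne, ae_eq_rfl, ae_eq_rfl⟩

end LinearSystem

theorem corollary2 {m n p : ℕ} (S : LinearSystem m n p)
    (U : Set (Fin m → ℝ)) (X : Set (Fin n → ℝ))
    (hS : S.IsInputRedundant Set.univ Set.univ)
    (x₀ : Fin n → ℝ) (y : Signal p)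
    (hadm : (x₀, y) ∈ S.admissiblePairs U X)
    (hnot : (x₀, y) ∉ S.redundantPairs U X) :
    (∃ (u : Signal m) (x : Signal n), (u, x, y) ∈ S.triples U X x₀) ∧
    (∀ (u₁ u₂ : Signal m) (x₁ x₂ : Signal n),
      (u₁, x₁, y) ∈ S.triples U X x₀ → (u₂, x₂, y) ∈ S.triples U X x₀ →
        Signal.AEEq u₁ u₂ ∧ Set.EqOn x₁ x₂ (Set.Ici 0)) ∧
    (∀ (u : Signal m) (x : Signal n), (u, x, y) ∈ S.triples U X x₀ →
      (0 < S.rho → ∀ t ∈ u.continuitySet, u t ∈ U \ interior U) ∧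
      (S.rho = 0 → ∀ t ∈ u.continuitySet,
        u t ∈ U \ interior U ∨ x t ∈ X \ interior X)) := by
  have unique {u₁ u₂ x₁ x₂} (h₁ : (u₁, x₁, y) ∈ S.triples U X x₀)
      (h₂ : (u₂, x₂, y) ∈ S.triples U X x₀) : u₁.AEEq u₂ :=
    LinearSystem.aeEq_of_notMem_redundantPairs hadm.1 hnot h₁ h₂
  refine ⟨hadm.2, fun u₁ u₂ x₁ x₂ h₁ h₂ => ⟨unique h₁ h₂, ?_⟩, fun u x h => ?_⟩
  · exact h₁.1.2.1.eqOn h₁.1.1 h₂.1.1 h₂.1.2.1 (unique h₁ h₂)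
  have mem_U {t} (ht : t ∈ u.continuitySet) : u t ∈ U :=
    h.2.1.1 t (Signal.continuousWithinAt_of_mem_continuitySet ht).1
  have mem_X {t} (ht : t ∈ u.continuitySet) : x t ∈ X :=
    h.2.2.1.1 t (Signal.continuousWithinAt_of_mem_continuitySet ht).1
  refine ⟨fun hρ t ht => ⟨mem_U ht, fun hU => ?_⟩, fun _ t ht => ?_⟩
  · obtain ⟨ω, hω, hω0⟩ := S.exists_isOutputNulling_of_rho_pos hρ
    obtain ⟨_, _, h', hne⟩ := LinearSystem.exists_triples_ne h hω hω0 ht hU (.inl rfl)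
    exact hne (unique h h')
  · refine or_iff_not_imp_left.2 fun hU => ⟨mem_X ht, fun hX => ?_⟩
    have hU : u t ∈ interior U := not_not.1 fun h0 => hU ⟨mem_U ht, h0⟩
    obtain ⟨ξ, ω, hω, hω0⟩ := hS.exists_isOutputNulling
    obtain ⟨_, _, h', hne⟩ := LinearSystem.exists_triples_ne h hω hω0 ht hU (.inr hX)
    exact hne (unique h h')
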